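/- For an algebraic integer $\alpha$ let $M(\alpha)=\prod_{i}\max(1,|\alpha_i|)$ be its Mahler measure, where the $\alpha_i$ are the complex roots of its minimal polynomial over $\mathbb{Q}$. For a number field $K$ with discriminant $D_K$ and ring of integers $\mathcal{O}_K$ let \[ M(\mathcal{O}_K)=\min\{M(\alpha) : \alpha\in\mathcal{O}_K,\ \mathbb{Q}(\alpha)=K,\ M(\alpha)\neq 1\}. \] (a) There are, up to isomorphism, infinitely many cyclic (equivalently, Galois) cubic fields $K$, infinitely many totally real non-Galois cubic fields $K$, and infinitely many cubic fields $K$ that are not totally real, such that \[ M(\mathcal{O}_K)\le 2^{1/2}\,|D_K|^{1/4}. \] (b) Consequently the exponent $1/4$ in Silverman's lower bound $3^{-3/4}|D_K|^{1/4}\le M(\mathcal{O}_K)$ for cubic fields cannot be increased for any of the three types: for every $c>0$ and every $e>1/4$ there is a field $K$ of the given type with $M(\mathcal{O}_K)<c\,|D_K|^{e}$. (c) More precisely, up to isomorphism, there are infinitely many cyclic cubic fields $K$ with $M(\mathcal{O}_K)<2^{1/2}|D_K|^{1/4}$ among the splitting fields of $x^3+nx^2-(n+3)x+1$; infinitely many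 totally real non-Galois cubic fields $K$ with $M(\mathcal{O}_K)<|D_K|^{1/4}$ among the fields $\mathbb{Q}(\alpha)$ with $\alpha$ a root of $x^3-nx^2+n$; and infinitely many cubic fields $K$ that are not totally real, with $M(\mathcal{O}_K)<2^{-1/2}|D_K|^{1/4}$, among the fields $\mathbb{Q}(\alpha)$ with $\alpha$ a root of $x^3+nx^2+n$. Here $n$ ranges over the natural numbers. -/

import Mathlib

open Polynomial Module

namespace CubicMahler

noncomputable section

/-- The Mahler measure of an algebraic integer `α`: the Mahler measure of its minimal polynomial
over `ℤ` (monic, hence of content one), viewed in `ℂ[X]`. -/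
def mahler {K : Type*} [Field K] (α : NumberField.RingOfIntegers K) : ℝ :=
  ((minpoly ℤ (α : K)).map (Int.castRingHom ℂ)).mahlerMeasure

/-- The Mahler measures, other than `1`, of the integral generators of `K` over `ℚ`. -/
def integralMahlerValues (K : Type*) [Field K] [CharZero K] : Set ℝ :=
  {m | ∃ α : NumberField.RingOfIntegers K,
    IntermediateField.adjoin ℚ {(α : K)} = ⊤ ∧ mahler α ≠ 1 ∧ mahler α = m}

/-- `M(𝓞 K) = m`: the minimum over the non-torsion integral generators is attained, with
value `m`. -/
def HasMinIntegralMahler (K : Type*) [Field K] [CharZero K] (m : ℝ) : Prop :=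
  IsLeast (integralMahlerValues K) m

/-- The absolute value of the discriminant of `K`, as a real number. -/
def absDiscr (K : Type*) [Field K] [NumberField K] : ℝ :=
  |(NumberField.discr K : ℝ)|

/-- Galois cubic fields, that is, cubic fields which are cyclic over `ℚ`. -/
def IsCyclicCubic (K : Type*) [Field K] [NumberField K] : Prop :=
  finrank ℚ K = 3 ∧ IsGalois ℚ K ∧ IsCyclic (K ≃ₐ[ℚ] K)

def IsTotallyRealNonGaloisCubic (K : Type*) [Field K] [NumberField K] : Prop :=
  finrank ℚ K = 3 ∧ NumberField.IsTotallyReal K ∧ ¬ IsGalois ℚ K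

def IsNonTotallyRealCubic (K : Type*) [Field K] [NumberField K] : Prop :=
  finrank ℚ K = 3 ∧ ¬ NumberField.IsTotallyReal K

/-- Infinitely many number fields, up to isomorphism, satisfy `P`. Every number field is isomorphic
to a subfield of `ℂ`, so the fields are taken there. -/
def InfinitelyManyFields (P : (K : IntermediateField ℚ ℂ) → [NumberField K] → Prop) : Prop :=
  ∃ F : ℕ → IntermediateField ℚ ℂ,
    (∀ i, ∃ _ : NumberField (F i), P (F i)) ∧
    Pairwise fun i j => IsEmpty (F i ≃+* F j)

/-- No lower bound `c * |D_K| ^ e ≤ M(𝓞 K)` with `c > 0` and `e > 1/4` holds for all number fields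
`K` with the property `T`. -/
def ExponentQuarterIsSharp (T : (K : IntermediateField ℚ ℂ) → [NumberField K] → Prop) : Prop :=
  ∀ c e : ℝ, 0 < c → 1 / 4 < e →
    ∃ (K : IntermediateField ℚ ℂ) (_ : NumberField K), T K ∧
      ∃ m, HasMinIntegralMahler K m ∧ m < c * absDiscr K ^ e

/-- The simplest cubic polynomial `x³ + n x² - (n + 3) x + 1`. -/
def simplestCubic (n : ℕ) : ℚ[X] :=
  X ^ 3 + C (n : ℚ) * X ^ 2 - C ((n : ℚ) + 3) * X + 1

/-- The polynomial `x³ - n x² + n`. -/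
def realCubic (n : ℕ) : ℚ[X] :=
  X ^ 3 - C (n : ℚ) * X ^ 2 + C (n : ℚ)

/-- The polynomial `x³ + n x² + n`. -/
def complexCubic (n : ℕ) : ℚ[X] :=
  X ^ 3 + C (n : ℚ) * X ^ 2 + C (n : ℚ)

/-- `K` is the splitting field of `f` in `ℂ`. -/
def IsSplittingFieldIn (f : ℚ[X]) (K : IntermediateField ℚ ℂ) : Prop :=
  K = IntermediateField.adjoin ℚ (f.rootSet ℂ)

/-- `K` is generated over `ℚ` by one root of `f` in `ℂ`. -/
def IsRootField (f : ℚ[X]) (K : IntermediateField ℚ ℂ) : Prop :=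
  ∃ α ∈ f.rootSet ℂ, K = IntermediateField.adjoin ℚ {α}

end

end CubicMahler

open CubicMahler

/-
For infinitely many `n` each family yields a field whose discriminant is known exactly: a
sieve on `n = 12 t + 1` makes the relevant factors of the polynomial discriminant squarefree, and
Eisenstein's criterion, after a translation for the simplest cubics, rules out the remaining primes
as divisors of the index of `ℤ[θ]`. Thus `|D_K|` is `(n² + 3 n + 9)²` or `n² (4 n² ∓ 27)`, of order
`n⁴`, whereas the Mahler measure of the generator is `O(n)`. By Northcott's theorem the minimum
defining `M(𝓞 K)` is attained, so this one generator bounds it from above.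
-/

namespace CubicMahler

open Filter

section Sieve

lemma eventually_primeCounting_le_mul {ε : ℝ} (hε : 0 < ε) :
    ∀ᶠ n : ℕ in atTop, (Nat.primeCounting n : ℝ) ≤ ε * n := by
  have hcheb := tendsto_natCast_atTop_atTop.eventually
    (Chebyshev.eventually_primeCounting_le one_pos)
  have hlog := (Real.tendsto_log_atTop.comp
    tendsto_natCast_atTop_atTop).eventually_ge_atTop ((Real.log 4 + 1) / ε)
  filter_upwards [hcheb, hlog] with n hcheb hlog
  rw [Nat.floor_natCast] at hcheb
  have hlog4 : 0 < Real.log 4 := Real.log_pos (by norm_num)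
  have hpos : 0 < Real.log n := (by positivity : 0 < (Real.log 4 + 1) / ε).trans_le hlog
  rw [Function.comp_apply, div_le_iff₀' hε] at hlog
  calc (Nat.primeCounting n : ℝ) ≤ (Real.log 4 + 1) * n / Real.log n := hcheb
    _ ≤ ε * Real.log n * n / Real.log n := by gcongr
    _ = ε * n := by field_simp

lemma card_filter_natCast_mem_le {m : ℕ} (R : Finset (ZMod m)) (X : ℕ) :
    ((Finset.range X).filter fun t : ℕ ↦ (t : ZMod m) ∈ R).card ≤ R.card * (X / m + 1) := by
  rw [← Finset.card_range (X / m + 1), ← Finset.card_product]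
  refine Finset.card_le_card_of_injOn (fun t ↦ ((t : ZMod m), t / m)) (fun t ht ↦ ?_)
    fun s _ t _ h ↦ ?_
  · rw [Finset.mem_coe, Finset.mem_filter, Finset.mem_range] at ht
    exact Finset.mem_product.mpr
      ⟨ht.2, Finset.mem_range.mpr (Nat.lt_succ_of_le (Nat.div_le_div_right ht.1.le))⟩
  · obtain ⟨hmod, hdiv⟩ := Prod.mk.injEq .. ▸ h
    rw [← Nat.mod_add_div s m, (ZMod.natCast_eq_natCast_iff' s t m).mp hmod, hdiv,
      Nat.mod_add_div]

lemma sum_inv_sq_le {z : ℕ} (hz : z ≠ 0) (s : Finset ℕ) (hs : ∀ p ∈ s, z < p) :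
    ∑ p ∈ s, ((p : ℝ) ^ 2)⁻¹ ≤ (z : ℝ)⁻¹ := by
  have hsub : s ⊆ Finset.Ioc z (max z (s.sup id)) := fun p hp ↦
    Finset.mem_Ioc.mpr ⟨hs p hp, le_max_of_le_right (Finset.le_sup (f := id) hp)⟩
  calc ∑ p ∈ s, ((p : ℝ) ^ 2)⁻¹
      ≤ ∑ p ∈ Finset.Ioc z (max z (s.sup id)), ((p : ℝ) ^ 2)⁻¹ :=
        Finset.sum_le_sum_of_subset_of_nonneg hsub fun _ _ _ ↦ by positivity
    _ ≤ (z : ℝ)⁻¹ - ((max z (s.sup id) : ℕ) : ℝ)⁻¹ := sum_Ioc_inv_sq_le_sub hz (le_max_left ..)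
    _ ≤ (z : ℝ)⁻¹ := sub_le_self _ (by positivity)

variable {k z : ℕ} {R : ∀ p : ℕ, Finset (ZMod (p ^ 2))}

lemma card_biUnion_filter_natCast_mem_le (hz : z ≠ 0) (s : Finset ℕ)
    (hs : ∀ p ∈ s, z < p) (hR : ∀ p ∈ s, (R p).card ≤ k) (X : ℕ) :
    ((s.biUnion fun p ↦ (Finset.range X).filter fun t : ℕ ↦ (t : ZMod (p ^ 2)) ∈ R p).card : ℝ) ≤
      k * (X / z + s.card) := by
  have hcard (p) (hp : p ∈ s) :
      (((Finset.range X).filter fun t : ℕ ↦ (t : ZMod (p ^ 2)) ∈ R p).card : ℝ) ≤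
        k * (X * ((p : ℝ) ^ 2)⁻¹ + 1) := by
    have h := (card_filter_natCast_mem_le (R p) X).trans (Nat.mul_le_mul_right _ (hR p hp))
    have hdiv : ((X / p ^ 2 : ℕ) : ℝ) ≤ X * ((p : ℝ) ^ 2)⁻¹ := by
      rw [← div_eq_mul_inv, ← Nat.cast_pow]
      exact Nat.cast_div_le
    calc _ ≤ (k : ℝ) * ((X / p ^ 2 : ℕ) + 1) := by exact_mod_cast h
      _ ≤ _ := by gcongr
  calc _ ≤ ∑ p ∈ s, (((Finset.range X).filter fun t : ℕ ↦ (t : ZMod (p ^ 2)) ∈ R p).card : ℝ) :=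
        mod_cast Finset.card_biUnion_le
    _ ≤ ∑ p ∈ s, (k : ℝ) * (X * ((p : ℝ) ^ 2)⁻¹ + 1) := Finset.sum_le_sum hcard
    _ = k * (X * ∑ p ∈ s, ((p : ℝ) ^ 2)⁻¹ + s.card) := by
        rw [← Finset.mul_sum, Finset.sum_add_distrib, ← Finset.mul_sum, Finset.sum_const,
          nsmul_one]
    _ ≤ k * (X / z + s.card) := by
        rw [div_eq_mul_inv]
        gcongr
        exact sum_inv_sq_le hz s hs

lemma sub_le_of_forall_exists_natCast_mem (hz : z ≠ 0)
    (hR : ∀ p, p.Prime → z < p → (R p).card ≤ k) {B C : ℕ}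
    (hC : ∀ p t : ℕ, p.Prime → z < p → (t : ZMod (p ^ 2)) ∈ R p → p ≤ C * (t + 1))
    (hB : ∀ t ≥ B, ∃ p, p.Prime ∧ z < p ∧ (t : ZMod (p ^ 2)) ∈ R p) (X : ℕ) :
    (X : ℝ) - B ≤ k * (X / z + (C * X).primeCounting) := by
  let s := (Nat.primesLE (C * X)).filter (z < ·)
  have hs {p} (hp : p ∈ s) : p.Prime ∧ z < p :=
    ⟨(Nat.mem_primesLE.mp (Finset.mem_filter.mp hp).1).2, (Finset.mem_filter.mp hp).2⟩
  have hcover : Finset.Ico B X ⊆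
      s.biUnion fun p ↦ (Finset.range X).filter fun t : ℕ ↦ (t : ZMod (p ^ 2)) ∈ R p := by
    intro t ht
    obtain ⟨hBt, htX⟩ := Finset.mem_Ico.mp ht
    obtain ⟨p, hp, hpz, hmem⟩ := hB t hBt
    have hpX : p ≤ C * X := (hC p t hp hpz hmem).trans (Nat.mul_le_mul_left _ htX)
    exact Finset.mem_biUnion.mpr
      ⟨p, Finset.mem_filter.mpr ⟨Nat.mem_primesLE.mpr ⟨hpX, hp⟩, hpz⟩,
        Finset.mem_filter.mpr ⟨Finset.mem_range.mpr htX, hmem⟩⟩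
  calc (X : ℝ) - B ≤ (Finset.Ico B X).card := by
        rw [Nat.card_Ico, sub_le_iff_le_add]
        exact mod_cast Nat.sub_le_iff_le_add.mp le_rfl
    _ ≤ _ := Nat.cast_le.mpr (Finset.card_le_card hcover)
    _ ≤ k * (X / z + s.card) := card_biUnion_filter_natCast_mem_le hz s
        (fun p hp ↦ (hs hp).2) (fun p hp ↦ hR p (hs hp).1 (hs hp).2) X
    _ ≤ k * (X / z + (C * X).primeCounting) := by
        rw [← Nat.primesLE_card_eq_primeCounting]
        gcongr
        exact Finset.filter_subset _ _

theorem exists_forall_prime_natCast_notMem (hkz : k < z)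
    (hR : ∀ p, p.Prime → z < p → (R p).card ≤ k) {C : ℕ}
    (hC : ∀ p t : ℕ, p.Prime → z < p → (t : ZMod (p ^ 2)) ∈ R p → p ≤ C * (t + 1)) (B : ℕ) :
    ∃ t ≥ B, ∀ p : ℕ, p.Prime → z < p → (t : ZMod (p ^ 2)) ∉ R p := by
  by_contra! hbad
  have hz : (0 : ℝ) < z := mod_cast k.zero_le.trans_lt hkz
  have hC0 : 0 < C := by
    obtain ⟨p, hp, hpz, hmem⟩ := hbad B le_rfl
    exact pos_of_mul_pos_left (hp.pos.trans_le (hC p B hp hpz hmem)) (Nat.zero_le _)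
  have hCX : Tendsto (C * · : ℕ → ℕ) atTop atTop := tendsto_id.const_mul_atTop' hC0
  obtain ⟨X, hprime, hXB⟩ := ((hCX.eventually (eventually_primeCounting_le_mul
    (ε := 1 / (2 * z * (k + 1) * C)) (by positivity))).and
      (eventually_gt_atTop (2 * z * B))).exists
  have hsifted := sub_le_of_forall_exists_natCast_mem (by lia) hR hC hbad X
  have hπ : (k : ℝ) * (C * X).primeCounting ≤ X / (2 * z) := by
    calc (k : ℝ) * (C * X).primeCounting
        ≤ (k + 1) * (1 / (2 * z * (k + 1) * C) * (C * X : ℕ)) := by gcongr; linarith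
      _ = X / (2 * z) := by push_cast; field_simp
  have hB : (B : ℝ) < X / (2 * z) := by
    rw [lt_div_iff₀' (by positivity)]
    exact mod_cast hXB
  have hkz' : (k + 1 : ℝ) ≤ z := mod_cast hkz
  refine lt_irrefl (X : ℝ) ?_
  calc (X : ℝ) ≤ k * (X / z) + k * (C * X).primeCounting + B := by linarith
    _ < k * (X / z) + X / (2 * z) + X / (2 * z) := by linarith
    _ = (k + 1) * (X / z) := by field_simp; ring
    _ ≤ z * (X / z) := by gcongr
    _ = X := by field_simp

lemma eq_or_eq_neg_of_isUnit_two_mul_of_sq_eq_sq {A : Type*} [CommRing A] [IsLocalRing A]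
    {x y : A} (hx : IsUnit (2 * x)) (h : x ^ 2 = y ^ 2) : x = y ∨ x = -y := by
  have hmul : (x - y) * (x + y) = 0 := by linear_combination h
  rcases IsLocalRing.isUnit_or_isUnit_of_isUnit_add (a := x - y) (b := x + y)
    (by convert hx using 1; ring) with hu | hu
  · exact .inr (eq_neg_of_add_eq_zero_left (hu.mul_right_eq_zero.mp hmul))
  · exact .inl (sub_eq_zero.mp (hu.mul_left_eq_zero.mp hmul))

lemma card_le_two_of_sq_add_eq_zero {A : Type*} [CommRing A] [IsLocalRing A] {a b c : A}
    (h2 : IsUnit (2 : A)) (ha : IsUnit a) (hc : IsUnit c) (S : Finset A)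
    (hS : ∀ x ∈ S, (a * x + b) ^ 2 + c = 0) : S.card ≤ 2 := by
  classical
  rw [← Finset.card_image_of_injective S ((add_left_injective b).comp ha.mul_right_injective)]
  rcases S.eq_empty_or_nonempty with rfl | ⟨x, hx⟩
  · simp
  have hu : IsUnit (2 * (a * x + b)) := h2.mul <| (isUnit_pow_iff two_ne_zero).mp <|
    eq_neg_of_add_eq_zero_left (hS x hx) ▸ hc.neg
  refine (Finset.card_le_card (t := {a * x + b, -(a * x + b)}) ?_).trans Finset.card_le_two
  refine Finset.image_subset_iff.mpr fun y hy ↦ ?_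
  rw [Finset.mem_insert, Finset.mem_singleton, Function.comp_apply, eq_comm, ← neg_eq_iff_eq_neg,
    eq_comm (a := -_)]
  exact eq_or_eq_neg_of_isUnit_two_mul_of_sq_eq_sq hu
    (by linear_combination hS x hx - hS y hy)

instance isLocalRing_zmod_prime_pow (p n : ℕ) [Fact p.Prime] [NeZero n] :
    IsLocalRing (ZMod (p ^ n)) :=
  have : Fact (1 < p ^ n) := ⟨Nat.one_lt_pow (NeZero.ne n) (Fact.out : p.Prime).one_lt⟩
  .of_surjective' (PadicInt.toZModPow n) (ZMod.ringHom_surjective _)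

lemma card_le_one_of_mul_add_eq_zero {A : Type*} [Ring A] {a b : A} (ha : IsUnit a)
    (S : Finset A) (hS : ∀ x ∈ S, a * x + b = 0) : S.card ≤ 1 :=
  Finset.card_le_one.mpr fun x hx y hy ↦
    ha.mul_right_injective (add_right_cancel ((hS x hx).trans (hS y hy).symm))

lemma exists_residues_twelve_mul_add_one {p : ℕ} (hp : p.Prime) (hp4 : 4 < p) (b : ℕ) {c : ℤ}
    (hc : |c| = 27) :
    ∃ S : Finset (ZMod (p ^ 2)), S.card ≤ 3 ∧
      ∀ x, x ∈ S ↔ 12 * x + 1 = 0 ∨ (24 * x + b) ^ 2 + c = 0 := by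
  classical
  have := Fact.mk hp
  have hunit {m : ℕ} (hm : m ∣ (2 * 3) ^ 3) : IsUnit (m : ZMod (p ^ 2)) := by
    refine (ZMod.isUnit_iff_coprime _ _).mpr (Nat.Coprime.pow_right 2 ?_)
    refine (Nat.Coprime.coprime_dvd_left hm (Nat.Coprime.pow_left 3 ?_))
    exact Nat.Coprime.mul_left ((Nat.coprime_primes Nat.prime_two hp).mpr (by lia))
      ((Nat.coprime_primes Nat.prime_three hp).mpr (by lia))
  have hc' : IsUnit (c : ZMod (p ^ 2)) := by
    rcases (abs_eq (by norm_num)).mp hc with rfl | rfl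
    · exact_mod_cast hunit (m := 27) (by norm_num)
    · exact_mod_cast (hunit (m := 27) (by norm_num)).neg
  refine ⟨Finset.univ.filter (fun x ↦ 12 * x + 1 = 0) ∪
    Finset.univ.filter (fun x ↦ (24 * x + b) ^ 2 + c = 0), ?_, fun x ↦ by simp⟩
  refine (Finset.card_union_le _ _).trans (add_le_add (?_ : _ ≤ 1) (?_ : _ ≤ 2))
  · exact card_le_one_of_mul_add_eq_zero (mod_cast hunit (m := 12) (by norm_num)) _
      fun x hx ↦ (Finset.mem_filter.mp hx).2
  · exact card_le_two_of_sq_add_eq_zero (mod_cast hunit (m := 2) (by norm_num))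
      (mod_cast hunit (m := 24) (by norm_num)) hc' _ fun x hx ↦ (Finset.mem_filter.mp hx).2

lemma sq_add_ne_zero_of_abs_eq {c : ℤ} (hc : |c| = 27) (x : ℤ) : x ^ 2 + c ≠ 0 := by
  intro h
  obtain ⟨hx₁, hx₂⟩ := abs_lt.mp
    (abs_lt_of_sq_lt_sq (by linarith [neg_abs_le c] : x ^ 2 < 6 ^ 2) (by norm_num))
  rcases (abs_eq (by norm_num)).mp hc with rfl | rfl <;> interval_cases x <;> norm_num at h

lemma exists_forall_prime_sq_not_dvd (b : ℕ) {c : ℤ} (hc : |c| = 27) (B : ℕ) :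
    ∃ t ≥ B, ∀ p : ℕ, p.Prime → 4 < p →
      ¬ p ^ 2 ∣ 12 * t + 1 ∧ ¬ (p : ℤ) ^ 2 ∣ (24 * t + b) ^ 2 + c := by
  choose! R hcard hmem using fun p (hp : p.Prime) (hp4 : 4 < p) ↦
    exists_residues_twelve_mul_add_one hp hp4 b hc
  have hlin (p t : ℕ) : 12 * (t : ZMod (p ^ 2)) + 1 = 0 ↔ p ^ 2 ∣ 12 * t + 1 := by
    rw [← ZMod.natCast_eq_zero_iff]; push_cast; rfl
  have hquad (p t : ℕ) :
      (24 * (t : ZMod (p ^ 2)) + b) ^ 2 + c = 0 ↔ (p : ℤ) ^ 2 ∣ (24 * t + b) ^ 2 + c := by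
    rw [← Nat.cast_pow, ← ZMod.intCast_zmod_eq_zero_iff_dvd]; push_cast; rfl
  have hsize (p t : ℕ) (hp : p.Prime) (hp4 : 4 < p) (hmem' : (t : ZMod (p ^ 2)) ∈ R p) :
      p ≤ (b + 30) * (t + 1) := by
    rw [hmem p hp hp4, hlin, hquad] at hmem'
    suffices p ≤ 24 * t + b + 6 by nlinarith
    refine (Nat.pow_le_pow_iff_left two_ne_zero).mp ?_
    rcases hmem' with h | h
    · have hle := Nat.le_of_dvd (by positivity) h
      linarith [Nat.le_self_pow two_ne_zero (24 * t + b + 6)]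
    · have hle := Int.le_of_dvd (abs_pos.mpr (sq_add_ne_zero_of_abs_eq hc _)) ((dvd_abs _ _).mpr h)
      have habs : |(24 * t + b : ℤ) ^ 2 + c| ≤ (24 * t + b + 6) ^ 2 :=
        calc _ ≤ |(24 * t + b : ℤ) ^ 2| + |c| := abs_add_le _ _
          _ = (24 * t + b) ^ 2 + 27 := by rw [hc, abs_sq]
          _ ≤ _ := by nlinarith [(by positivity : (0 : ℤ) ≤ 24 * t + b)]
      exact mod_cast hle.trans habs
  obtain ⟨t, htB, ht⟩ :=
    exists_forall_prime_natCast_notMem (by norm_num : 3 < 4) hcard hsize B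
  refine ⟨t, htB, fun p hp hp4 ↦ ?_⟩
  rw [← hlin, ← hquad, ← not_or, ← hmem p hp hp4]
  exact ht p hp hp4

end Sieve

section SquarefreeValues

lemma squarefree_of_forall_prime_sq_not_dvd {m : ℤ} (h2 : ¬ 2 ∣ m) (h3 : ¬ 3 ∣ m)
    (hm : ∀ p : ℕ, p.Prime → 4 < p → ¬ (p : ℤ) ^ 2 ∣ m) : Squarefree m := by
  rw [← Int.squarefree_natAbs, Nat.squarefree_iff_prime_squarefree]
  intro p hp hdvd
  have hdvd' : (p : ℤ) ^ 2 ∣ m := by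
    rw [sq]
    exact_mod_cast Int.natCast_dvd.mpr hdvd
  have hpm : (p : ℤ) ∣ m := (dvd_pow_self _ two_ne_zero).trans hdvd'
  refine hm p hp (lt_of_not_ge fun hp4 ↦ ?_) hdvd'
  have := hp.two_le
  interval_cases p
  · exact h2 hpm
  · exact h3 hpm
  · exact absurd hp (by decide)

lemma exists_squarefree_trinomial_discr {k : ℤ} (hk : |k| = 1) (B : ℕ) :
    ∃ n ≥ B, Odd n ∧ Squarefree (n : ℤ) ∧ Squarefree (4 * k ^ 3 * (n : ℤ) ^ 2 + 27) := by
  obtain ⟨t, hBt, ht⟩ := exists_forall_prime_sq_not_dvd 2 (c := 27 * k) (by simp [abs_mul, hk]) B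
  have hk2 : k ^ 2 = 1 := by rw [← sq_abs, hk, one_pow]
  have hmod : 4 * k ^ 3 * ((12 * t + 1 : ℕ) : ℤ) ^ 2 + 27 =
      12 * (k * (48 * t ^ 2 + 8 * t) + 2) + 4 * k + 3 := by
    push_cast
    linear_combination 4 * k * (12 * (t : ℤ) + 1) ^ 2 * hk2
  refine ⟨12 * t + 1, by omega, ⟨6 * t, by ring⟩,
    squarefree_of_forall_prime_sq_not_dvd (by omega) (by omega) fun p hp hp4 ↦ ?_,
    squarefree_of_forall_prime_sq_not_dvd ?_ ?_ fun p hp hp4 h ↦ (ht p hp hp4).2 ?_⟩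
  · exact_mod_cast (ht p hp hp4).1
  · omega
  · rcases abs_eq_abs.mp (hk.trans abs_one.symm) with rfl | rfl <;> omega
  · refine (h.mul_left k).trans (dvd_of_eq ?_)
    push_cast
    linear_combination 4 * (k ^ 2 + 1) * (12 * (t : ℤ) + 1) ^ 2 * hk2

lemma exists_squarefree_simplest_discr (B : ℕ) :
    ∃ n ≥ B, Squarefree ((n : ℤ) ^ 2 + 3 * n + 9) := by
  obtain ⟨t, hBt, ht⟩ := exists_forall_prime_sq_not_dvd 5 (c := 27) (by simp) B
  have hmod : ((12 * t + 1 : ℕ) : ℤ) ^ 2 + 3 * (12 * t + 1 : ℕ) + 9 =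
      12 * (12 * t ^ 2 + 5 * t + 1) + 1 := by
    push_cast
    ring
  refine ⟨12 * t + 1, by omega,
    squarefree_of_forall_prime_sq_not_dvd (by omega) (by omega) fun p hp hp4 h ↦
      (ht p hp hp4).2 ?_⟩
  refine (h.mul_left 4).trans (dvd_of_eq ?_)
  push_cast
  ring

end SquarefreeValues

section NorthcottMinimum

lemma natDegree_minpoly_int {K : Type*} [Field K] [CharZero K] {x : K} (hx : IsIntegral ℤ x) :
    (minpoly ℤ x).natDegree = (minpoly ℚ x).natDegree := by
  rw [minpoly.isIntegrallyClosed_eq_field_fractions' ℚ hx, (minpoly.monic hx).natDegree_map]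

lemma finite_integralMahlerValues_inter_Iic (K : Type*) [Field K] [NumberField K] (B : ℝ) :
    (integralMahlerValues K ∩ Set.Iic B).Finite := by
  refine ((finite_mahlerMeasure_le (finrank ℚ K) B.toNNReal).image
    fun p : ℤ[X] ↦ (p.map (Int.castRingHom ℂ)).mahlerMeasure).subset ?_
  rintro _ ⟨⟨β, -, -, rfl⟩, hβ⟩
  exact ⟨minpoly ℤ (β : K), ⟨(natDegree_minpoly_int β.isIntegral_coe).trans_le
    (minpoly.natDegree_le _), le_trans hβ (Real.le_coe_toNNReal _)⟩, rfl⟩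

lemma exists_hasMinIntegralMahler_le {K : Type*} [Field K] [NumberField K]
    {α : NumberField.RingOfIntegers K} (hα : IntermediateField.adjoin ℚ {(α : K)} = ⊤)
    (hα₁ : mahler α ≠ 1) : ∃ m, HasMinIntegralMahler K m ∧ m ≤ mahler α := by
  have hmem : mahler α ∈ integralMahlerValues K := ⟨α, hα, hα₁, rfl⟩
  obtain ⟨m, hm⟩ := (finite_integralMahlerValues_inter_Iic K (mahler α)).exists_minimal
    ⟨_, hmem, le_refl (mahler α)⟩
  refine ⟨m, ⟨hm.1.1, fun x hx ↦ ?_⟩, hm.1.2⟩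
  rcases le_total x m with hxm | hmx
  · exact hm.2 ⟨hx, hxm.trans hm.1.2⟩ hxm
  · exact hmx

end NorthcottMinimum

section UnboundedDiscriminant

variable {P Q : (K : IntermediateField ℚ ℂ) → [NumberField K] → Prop}

/-- The number fields with the property `P` have arbitrarily large absolute discriminants. This is
how all the fields of `theorem1` are produced: large discriminants give both infinitely many
isomorphism classes and the sharpness of an exponent. -/
def HasUnboundedDiscr (P : (K : IntermediateField ℚ ℂ) → [NumberField K] → Prop) : Prop :=
  ∀ B : ℝ, ∃ (K : IntermediateField ℚ ℂ) (_ : NumberField K), P K ∧ B < absDiscr K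

lemma HasUnboundedDiscr.mono (hP : HasUnboundedDiscr P)
    (h : ∀ (K : IntermediateField ℚ ℂ) [NumberField K], P K → Q K) : HasUnboundedDiscr Q :=
  fun B ↦
    let ⟨K, hK, hPK, hB⟩ := hP B
    ⟨K, hK, h K hPK, hB⟩

lemma HasUnboundedDiscr.infinitelyManyFields (hP : HasUnboundedDiscr P) :
    InfinitelyManyFields P := by
  choose G hG hPG hB using hP
  let d : ℕ → ℝ := fun k ↦ Nat.rec 0 (fun _ x ↦ @absDiscr (G x) _ (hG x)) k
  have hd : StrictMono d := strictMono_nat_of_lt_succ fun k ↦ hB (d k)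
  refine ⟨fun k ↦ G (d k), fun k ↦ ⟨hG _, hPG _⟩, fun i j hij ↦ ⟨fun e ↦ hij ?_⟩⟩
  have := hG (d i)
  have := hG (d j)
  have hsucc : d (i + 1) = d (j + 1) := by
    change absDiscr (G (d i)) = absDiscr (G (d j))
    rw [absDiscr, absDiscr, NumberField.discr_eq_discr_of_ringEquiv _ e]
  exact Nat.succ_injective (hd.injective hsucc)

lemma HasUnboundedDiscr.exponentQuarterIsSharp {C : ℝ}
    (h : HasUnboundedDiscr fun K _ ↦
      P K ∧ ∃ m, HasMinIntegralMahler K m ∧ m ≤ C * absDiscr K ^ (1 / 4 : ℝ)) :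
    ExponentQuarterIsSharp P := by
  intro c e hc he
  obtain ⟨B, hB⟩ := eventually_atTop.mp
    ((tendsto_rpow_atTop (sub_pos.mpr he)).eventually_gt_atTop (C / c))
  obtain ⟨K, hK, ⟨hPK, m, hm, hmC⟩, hD⟩ := h (max B 0)
  refine ⟨K, hK, hPK, m, hm, hmC.trans_lt ?_⟩
  have hpos : 0 < absDiscr K := (le_max_right B 0).trans_lt hD
  calc C * absDiscr K ^ (1 / 4 : ℝ)
      < absDiscr K ^ (e - 1 / 4) * c * absDiscr K ^ (1 / 4 : ℝ) :=
        mul_lt_mul_of_pos_right ((div_lt_iff₀ hc).mp (hB _ ((le_max_left B 0).trans hD.le)))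
          (Real.rpow_pos_of_pos hpos _)
    _ = c * (absDiscr K ^ (e - 1 / 4) * absDiscr K ^ (1 / 4 : ℝ)) := by ring
    _ = c * absDiscr K ^ e := by rw [← Real.rpow_add hpos, sub_add_cancel]

lemma lt_mul_rpow_quarter {x c D : ℝ} (hc : 0 ≤ c) (hD : 0 ≤ D) (h : x ^ 4 < c ^ 4 * D) :
    x < c * D ^ (1 / 4 : ℝ) := by
  refine lt_of_pow_lt_pow_left₀ 4 (by positivity) (h.trans_eq ?_)
  rw [mul_pow, ← Real.rpow_natCast (D ^ _), ← Real.rpow_mul hD]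
  norm_num

end UnboundedDiscriminant

section PolynomialDiscriminant

lemma discr_map_of_monic {R S : Type*} [CommRing R] [CommRing S] [Nontrivial S] (φ : R →+* S)
    {f : R[X]} (hf : f.Monic) (hdeg : 0 < f.natDegree) : (f.map φ).discr = φ f.discr := by
  have : Nontrivial R := φ.domain_nontrivial
  have hmap := resultant_map_map f (derivative f) f.natDegree (f.natDegree - 1) φ
  have hf' := resultant_deriv (natDegree_pos_iff_degree_pos.mp hdeg)
  have hfφ := resultant_deriv (f := f.map φ)
    (natDegree_pos_iff_degree_pos.mp (by rwa [hf.natDegree_map]))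
  rw [hf.natDegree_map, derivative_map, hmap, hf', (hf.map φ).leadingCoeff, hf.leadingCoeff,
    mul_one, mul_one, map_mul, map_pow, map_neg, map_one] at hfφ
  exact (((isUnit_one.neg.pow _).mul_right_injective) hfφ).symm

variable {K L : Type*} [Field K] [Field L] [Algebra K L] [FiniteDimensional K L]
  [Algebra.IsSeparable K L]

lemma norm_aeval_gen_eq_prod_aroots (E : Type*) [Field E] [Algebra K E] [IsAlgClosed E]
    (pb : PowerBasis K L) (g : K[X]) :
    algebraMap K E (Algebra.norm K (aeval pb.gen g)) =
      (((minpoly K pb.gen).aroots E).map (aeval · g)).prod := by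
  classical
  rw [Algebra.norm_eq_prod_embeddings K E]
  simp only [← aeval_algHom_apply]
  rw [Fintype.prod_equiv pb.liftEquiv' (fun σ ↦ aeval (σ pb.gen) g) (fun x ↦ aeval x.1 g)
      fun σ ↦ by rw [PowerBasis.liftEquiv'_apply_coe],
    ← Finset.prod_subtype _ (fun _ ↦ Multiset.mem_toFinset) (aeval · g),
    Finset.prod_eq_multiset_prod, Multiset.toFinset_val, Multiset.dedup_eq_self.mpr]
  exact nodup_roots (.map (Algebra.IsSeparable.isSeparable K pb.gen))

lemma discr_powerBasis_eq_discr_minpoly (pb : PowerBasis K L) :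
    Algebra.discr K pb.basis = (minpoly K pb.gen).discr := by
  let E := AlgebraicClosure L
  let f := minpoly K pb.gen
  have h_int : IsIntegral K pb.gen := .of_finite ..
  have hdeg : 0 < f.natDegree := minpoly.natDegree_pos h_int
  have hmonic : f.Monic := minpoly.monic h_int
  have hres := resultant_deriv
    (natDegree_pos_iff_degree_pos.mp (hdeg.trans_eq (hmonic.natDegree_map (algebraMap K E)).symm))
  rw [resultant_eq_prod_eval _ _ _ (natDegree_derivative_le _) (IsAlgClosed.splits _),
    (hmonic.map _).leadingCoeff, one_pow, one_mul, mul_one, hmonic.natDegree_map,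
    discr_map_of_monic _ hmonic hdeg, derivative_map] at hres
  apply (algebraMap K E).injective
  rw [Algebra.discr_powerBasis_eq_norm, map_mul, norm_aeval_gen_eq_prod_aroots E]
  simp only [aroots, aeval_def, ← eval_map]
  rw [hres, pb.finrank, ← pb.natDegree_minpoly, map_pow, map_neg, map_one, ← mul_assoc,
    ← mul_pow, neg_one_mul, neg_neg, one_pow, one_mul]

end PolynomialDiscriminant

section Index

open NumberField

variable {K : Type*} [Field K]

lemma coe_mem_adjoin_coe_iff {θ x : 𝓞 K} :
    (x : K) ∈ Algebra.adjoin ℤ {(θ : K)} ↔ x ∈ Algebra.adjoin ℤ {θ} := by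
  have h := AlgHom.map_adjoin_singleton (IsScalarTower.toAlgHom ℤ (𝓞 K) K) θ
  rw [IsScalarTower.coe_toAlgHom'] at h
  rw [← h]
  exact RingOfIntegers.coe_injective.mem_set_image

variable [NumberField K]

lemma coe_discr_int {ι : Type*} [Fintype ι] [DecidableEq ι] (v : ι → 𝓞 K) :
    (Algebra.discr ℤ v : ℚ) = Algebra.discr ℚ fun i ↦ (v i : K) := by
  rw [Algebra.discr_def, Algebra.discr_def, ← eq_intCast (algebraMap ℤ ℚ), RingHom.map_det]
  congr 1
  ext i j
  simp [Algebra.traceMatrix_apply, Algebra.traceForm_apply, Algebra.coe_trace_int]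

lemma adjoin_coe_eq_top {θ : 𝓞 K} (hθ : IntermediateField.adjoin ℚ {(θ : K)} = ⊤) :
    Algebra.adjoin ℚ {(θ : K)} = ⊤ :=
  Algebra.adjoin_eq_top_of_intermediateField (fun _ _ ↦ Algebra.IsAlgebraic.isAlgebraic _) hθ

lemma natDegree_minpoly_of_adjoin_eq_top {θ : 𝓞 K}
    (hθ : IntermediateField.adjoin ℚ {(θ : K)} = ⊤) :
    (minpoly ℤ θ).natDegree = finrank ℚ K := by
  rw [← (Field.primitive_element_iff_minpoly_natDegree_eq ℚ (θ : K)).mp hθ,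
    ← natDegree_minpoly_int θ.isIntegral_coe, RingOfIntegers.minpoly_coe]

lemma discr_powers_eq_discr_minpoly {θ : 𝓞 K} (hθ : IntermediateField.adjoin ℚ {(θ : K)} = ⊤) :
    Algebra.discr ℤ (fun i : Fin (minpoly ℤ θ).natDegree ↦ θ ^ (i : ℕ)) = (minpoly ℤ θ).discr := by
  have h_int : IsIntegral ℚ (θ : K) := .of_finite ..
  let pb := PowerBasis.ofAdjoinEqTop h_int (adjoin_coe_eq_top hθ)
  have hpb : minpoly ℚ pb.gen = (minpoly ℤ θ).map (algebraMap ℤ ℚ) := by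
    rw [PowerBasis.ofAdjoinEqTop_gen, ← RingOfIntegers.minpoly_coe,
      minpoly.isIntegrallyClosed_eq_field_fractions' ℚ θ.isIntegral_coe]
  have hmonic : (minpoly ℤ θ).Monic := minpoly.monic (RingOfIntegers.isIntegral θ)
  have hdim : pb.dim = (minpoly ℤ θ).natDegree := by
    rw [← pb.natDegree_minpoly, hpb, hmonic.natDegree_map]
  have h := discr_powerBasis_eq_discr_minpoly pb
  rw [hpb, discr_map_of_monic _ hmonic (minpoly.natDegree_pos (RingOfIntegers.isIntegral θ))] at h
  apply (algebraMap ℤ ℚ).injective_int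
  rw [← h, eq_intCast, coe_discr_int, ← Algebra.discr_reindex ℚ _ (finCongr hdim)]
  congr
  ext i
  rw [Function.comp_apply, pb.basis_eq_pow, PowerBasis.ofAdjoinEqTop_gen]
  exact map_pow (algebraMap (𝓞 K) K) θ i

lemma discr_minpoly_eq_card_quotient_sq_mul_discr {θ : 𝓞 K}
    (hθ : IntermediateField.adjoin ℚ {(θ : K)} = ⊤) :
    (minpoly ℤ θ).discr =
      Nat.card (𝓞 K ⧸ (Algebra.adjoin ℤ {θ}).toSubmodule) ^ 2 * discr K := by
  have h_int := RingOfIntegers.isIntegral θ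
  let N := (Algebra.adjoin ℤ {θ}).toSubmodule
  let bN : Basis (Fin (minpoly ℤ θ).natDegree) ℤ N := (Algebra.adjoin.powerBasis' h_int).basis
  have hbN : Subtype.val ∘ bN = fun i : Fin _ ↦ θ ^ (i : ℕ) := funext fun i ↦
    congrArg Subtype.val <| ((Algebra.adjoin.powerBasis' h_int).basis_eq_pow i).trans <|
      congrArg (· ^ (i : ℕ)) (Algebra.adjoin.powerBasis'_gen h_int)
  have hcard : Fintype.card (Free.ChooseBasisIndex ℤ (𝓞 K)) =
      Fintype.card (Fin (minpoly ℤ θ).natDegree) := by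
    rw [Fintype.card_fin, natDegree_minpoly_of_adjoin_eq_top hθ,
      ← RingOfIntegers.rank, finrank_eq_card_chooseBasisIndex]
  let b := (RingOfIntegers.basis K).reindex (Fintype.equivOfCardEq hcard)
  rw [← discr_powers_eq_discr_minpoly hθ, ← hbN, ← discr_eq_discr K b,
    ← Submodule.natAbs_det_basis_change b N bN, Int.natCast_natAbs, sq_abs, Basis.det_apply,
    ← Algebra.discr_of_matrix_vecMul, b.toMatrix_map_vecMul]

/-- The order `ℤ[θ]` is maximal at the prime `p`: its index in `𝓞 K` is prime to `p`. -/
def IsMaximalAt (p : ℕ) (θ : 𝓞 K) : Prop :=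
  ∀ z : 𝓞 K, p • z ∈ Algebra.adjoin ℤ {θ} → z ∈ Algebra.adjoin ℤ {θ}

lemma finite_quotient_adjoin {θ : 𝓞 K} (hθ : IntermediateField.adjoin ℚ {(θ : K)} = ⊤) :
    Finite (𝓞 K ⧸ (Algebra.adjoin ℤ {θ}).toSubmodule) := by
  have h_int := RingOfIntegers.isIntegral θ
  have : Free ℤ (Algebra.adjoin ℤ {θ}).toSubmodule :=
    .of_basis (Algebra.adjoin.powerBasis' h_int).basis
  refine Submodule.finiteQuotientOfFreeOfRankEq _ ?_
  rw [RingOfIntegers.rank, ← natDegree_minpoly_of_adjoin_eq_top hθ]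
  exact (Algebra.adjoin.powerBasis' h_int).finrank

theorem discr_eq_discr_minpoly {θ : 𝓞 K} (hθ : IntermediateField.adjoin ℚ {(θ : K)} = ⊤)
    (hmax : ∀ p : ℕ, p.Prime → (p : ℤ) ^ 2 ∣ (minpoly ℤ θ).discr → IsMaximalAt p θ) :
    discr K = (minpoly ℤ θ).discr := by
  have hindex := discr_minpoly_eq_card_quotient_sq_mul_discr hθ
  suffices Nat.card (𝓞 K ⧸ (Algebra.adjoin ℤ {θ}).toSubmodule) = 1 by
    rw [hindex, this, Nat.cast_one, one_pow, one_mul]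
  by_contra hne
  obtain ⟨p, hp, hdvd⟩ := Nat.exists_prime_and_dvd hne
  have := Fact.mk hp
  have := finite_quotient_adjoin hθ
  obtain ⟨z, hz⟩ := exists_prime_addOrderOf_dvd_card' p hdvd
  obtain ⟨z, rfl⟩ := Submodule.Quotient.mk_surjective _ z
  have hpz : p • z ∈ Algebra.adjoin ℤ {θ} := by
    rw [← Subalgebra.mem_toSubmodule, ← Submodule.Quotient.mk_eq_zero, Submodule.Quotient.mk_smul,
      ← hz, addOrderOf_nsmul_eq_zero]
  have hpd : (p : ℤ) ^ 2 ∣ (minpoly ℤ θ).discr :=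
    hindex ▸ (pow_dvd_pow_of_dvd (Int.natCast_dvd_natCast.mpr hdvd) 2).mul_right _
  have hz0 := (Submodule.Quotient.mk_eq_zero (Algebra.adjoin ℤ {θ}).toSubmodule).mpr
    (hmax p hp hpd z hpz)
  rw [hz0, addOrderOf_zero] at hz
  exact hp.one_lt.ne hz

lemma isMaximalAt_of_isEisensteinAt {p : ℕ} (hp : p.Prime) {θ : 𝓞 K}
    (hθ : IntermediateField.adjoin ℚ {(θ : K)} = ⊤)
    (hE : (minpoly ℤ θ).IsEisensteinAt (Ideal.span {(p : ℤ)})) : IsMaximalAt p θ := by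
  intro z hz
  let pb := PowerBasis.ofAdjoinEqTop (.of_finite ℚ (θ : K)) (adjoin_coe_eq_top hθ)
  have hgen : pb.gen = θ := PowerBasis.ofAdjoinEqTop_gen ..
  rw [← coe_mem_adjoin_coe_iff, ← hgen]
  refine mem_adjoin_of_smul_prime_smul_of_minpoly_isEisensteinAt (Nat.prime_iff_prime_int.mp hp)
    (hgen ▸ θ.isIntegral_coe) z.isIntegral_coe ?_ ?_
  · rw [hgen, natCast_zsmul]
    exact_mod_cast coe_mem_adjoin_coe_iff.mpr hz
  · rwa [hgen, RingOfIntegers.minpoly_coe]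

/-- Translates of `θ` generate the same order, so Eisenstein's criterion may be applied to any of
their minimal polynomials. -/
lemma isMaximalAt_of_isEisensteinAt_comp {p : ℕ} (hp : p.Prime) {θ : 𝓞 K}
    (hθ : IntermediateField.adjoin ℚ {(θ : K)} = ⊤) (k : ℤ)
    (hE : ((minpoly ℤ θ).comp (X - C k)).IsEisensteinAt (Ideal.span {(p : ℤ)})) :
    IsMaximalAt p θ := by
  have hmin : minpoly ℤ (θ + algebraMap ℤ (𝓞 K) k) = (minpoly ℤ θ).comp (X - C k) := by
    apply map_injective _ (algebraMap ℤ ℚ).injective_int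
    rw [← RingOfIntegers.minpoly_coe, ← RingOfIntegers.minpoly_coe, Polynomial.map_comp,
      ← minpoly.isIntegrallyClosed_eq_field_fractions' ℚ (RingOfIntegers.isIntegral_coe _),
      ← minpoly.isIntegrallyClosed_eq_field_fractions' ℚ θ.isIntegral_coe, map_add,
      ← IsScalarTower.algebraMap_apply, IsScalarTower.algebraMap_apply ℤ ℚ K,
      minpoly.add_algebraMap, Polynomial.map_sub, map_X, map_C]
  have hadj : Algebra.adjoin ℤ {θ + algebraMap ℤ (𝓞 K) k} = Algebra.adjoin ℤ {θ} := by
    apply le_antisymm <;> apply Algebra.adjoin_singleton_le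
    · exact add_mem (Algebra.self_mem_adjoin_singleton ℤ θ) (algebraMap_mem _ k)
    · simpa using sub_mem (Algebra.self_mem_adjoin_singleton ℤ (θ + algebraMap ℤ (𝓞 K) k))
        (algebraMap_mem _ k)
  have hθk : IntermediateField.adjoin ℚ {((θ + algebraMap ℤ (𝓞 K) k : 𝓞 K) : K)} = ⊤ := by
    rw [eq_top_iff, ← hθ, IntermediateField.adjoin_simple_le_iff]
    simpa using sub_mem (IntermediateField.mem_adjoin_simple_self ℚ
      ((θ + algebraMap ℤ (𝓞 K) k : 𝓞 K) : K)) (intCast_mem _ k)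
  unfold IsMaximalAt
  rw [← hadj]
  exact isMaximalAt_of_isEisensteinAt hp hθk (hmin ▸ hE)

end Index

section GaloisDiscriminant

variable {K L : Type*} [Field K] [Field L] [Algebra K L] [FiniteDimensional K L]

lemma isSquare_of_isSquare_algebraMap_of_odd_finrank (hL : Odd (finrank K L)) {a : K}
    (ha : IsSquare (algebraMap K L a)) : IsSquare a := by
  obtain ⟨d, hd⟩ := ha
  obtain ⟨k, hk⟩ := hL
  rcases eq_or_ne a 0 with rfl | ha₀
  · exact .zero
  have hnorm : a ^ (2 * k + 1) = Algebra.norm K d * Algebra.norm K d := by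
    rw [← hk, ← Algebra.norm_algebraMap, hd, map_mul]
  refine ⟨Algebra.norm K d / a ^ k, ?_⟩
  rw [div_mul_div_comm, ← hnorm, eq_div_iff (mul_self_ne_zero.mpr (pow_ne_zero k ha₀))]
  ring

lemma isSquare_algebraMap_discr_of_isGalois [IsGalois K L] {ι : Type*} [Fintype ι] [DecidableEq ι]
    (b : Basis ι K L) : IsSquare (algebraMap K L (Algebra.discr K b)) := by
  have hcard : Fintype.card ι = Fintype.card Gal(L/K) := by
    rw [← finrank_eq_card_basis b, ← Nat.card_eq_fintype_card, IsGalois.card_aut_eq_finrank]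
  let e := Fintype.equivOfCardEq hcard
  let A : Matrix ι ι L := .of fun i j ↦ e j (b i)
  refine ⟨A.det, ?_⟩
  have hA : (Algebra.traceMatrix K b).map (algebraMap K L) = A * A.transpose := by
    ext i j
    simp only [Matrix.map_apply, Algebra.traceMatrix_apply, Algebra.traceForm_apply,
      trace_eq_sum_automorphisms, Matrix.mul_apply, Matrix.transpose_apply, A, Matrix.of_apply,
      ← map_mul]
    exact (e.sum_comp fun σ ↦ σ (b i * b j)).symm
  rw [Algebra.discr_def, RingHom.map_det, RingHom.mapMatrix_apply, hA, Matrix.det_mul,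
    Matrix.det_transpose]

end GaloisDiscriminant

section FieldTypes

open NumberField

variable {K : Type*} [Field K] [NumberField K]

lemma isSquare_discr_of_isGalois_of_odd_finrank [IsGalois ℚ K] (hK : Odd (finrank ℚ K)) :
    IsSquare (discr K) := by
  rw [← Rat.isSquare_intCast_iff, coe_discr]
  exact isSquare_of_isSquare_algebraMap_of_odd_finrank hK (isSquare_algebraMap_discr_of_isGalois _)

lemma isTotallyReal_iff_discr_pos_of_finrank_le_three (hK : finrank ℚ K ≤ 3) :
    IsTotallyReal K ↔ 0 < discr K := by
  have hplaces := InfinitePlace.card_add_two_mul_card_eq_rank K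
  rw [← nrComplexPlaces_eq_zero_iff, ← Int.sign_eq_one_iff_pos, sign_discr]
  obtain h | h : InfinitePlace.nrComplexPlaces K = 0 ∨ InfinitePlace.nrComplexPlaces K = 1 := by
    omega
  all_goals simp [h]

lemma isCyclicCubic_of_isGalois [IsGalois ℚ K] (hK : finrank ℚ K = 3) : IsCyclicCubic K := by
  have := Fact.mk Nat.prime_three
  exact ⟨hK, inferInstance, isCyclic_of_prime_card ((IsGalois.card_aut_eq_finrank ℚ K).trans hK)⟩

end FieldTypes

section MonicCubic

variable {R : Type*} [CommRing R] (b c d : R)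

/-- The monic cubic polynomial `X³ + b X² + c X + d`. -/
noncomputable def monicCubic : R[X] :=
  (⟨1, b, c, d⟩ : Cubic R).toPoly

lemma monic_monicCubic : (monicCubic b c d).Monic :=
  Cubic.monic_of_a_eq_one'

lemma aeval_monicCubic {A : Type*} [CommRing A] [Algebra R A] (x : A) :
    aeval x (monicCubic b c d) =
      x ^ 3 + algebraMap R A b * x ^ 2 + algebraMap R A c * x + algebraMap R A d := by
  simp [monicCubic, Cubic.toPoly]

lemma map_monicCubic {S : Type*} [CommRing S] (φ : R →+* S) :
    (monicCubic b c d).map φ = monicCubic (φ b) (φ c) (φ d) := by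
  simp [monicCubic, ← Cubic.map_toPoly, Cubic.map]

lemma natDegree_monicCubic [Nontrivial R] : (monicCubic b c d).natDegree = 3 :=
  Cubic.natDegree_of_a_ne_zero' one_ne_zero

lemma discr_monicCubic [Nontrivial R] : (monicCubic b c d).discr =
    b ^ 2 * c ^ 2 - 4 * c ^ 3 - 4 * b ^ 3 * d - 27 * d ^ 2 + 18 * b * c * d := by
  rw [monicCubic, discr_of_degree_eq_three (Cubic.degree_of_a_ne_zero' one_ne_zero)]
  simp

lemma monicCubic_comp_X_sub_C (k : R) : (monicCubic b c d).comp (X - C k) =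
    monicCubic (b - 3 * k) (3 * k ^ 2 - 2 * b * k + c) (-k ^ 3 + b * k ^ 2 - c * k + d) := by
  simp only [monicCubic, Cubic.toPoly, add_comp, mul_comp, C_comp, pow_comp, X_comp, one_comp,
    map_add, map_sub, map_neg, map_mul, map_pow, map_ofNat, map_one]
  ring

variable {b c d}

lemma monicCubic_eq_prod_iff {x y z : R} :
    monicCubic b c d = (X - C x) * (X - C y) * (X - C z) ↔
      b = -(x + y + z) ∧ c = x * y + x * z + y * z ∧ d = -(x * y * z) := by
  rw [Cubic.prod_X_sub_C_eq, monicCubic, Cubic.toPoly_injective]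
  simp

lemma monicCubic_eq_prod_of_roots [IsDomain R] {x y z : R} (hx : (monicCubic b c d).IsRoot x)
    (hy : (monicCubic b c d).IsRoot y) (hz : (monicCubic b c d).IsRoot z) (hxy : x ≠ y)
    (hxz : x ≠ z) (hyz : y ≠ z) : monicCubic b c d = (X - C x) * (X - C y) * (X - C z) := by
  have hmonic := monic_monicCubic b c d
  have hle : ({x, y, z} : Multiset R) ≤ (monicCubic b c d).roots := by
    rw [Multiset.le_iff_subset (by simp [*])]
    simpa [Multiset.insert_eq_cons, Multiset.cons_subset, hmonic.ne_zero] using ⟨hx, hy, hz⟩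
  have hroots : (monicCubic b c d).roots = {x, y, z} :=
    (Multiset.eq_of_le_of_card_le hle
      ((card_roots' _).trans_eq (natDegree_monicCubic b c d))).symm
  rw [← prod_multiset_X_sub_C_of_monic_of_roots_card_eq hmonic
    (by rw [hroots, natDegree_monicCubic]; rfl), hroots]
  simp [mul_assoc]

end MonicCubic

section IntegralCubic

variable {b c d : ℤ}

lemma irreducible_monicCubic_of_odd (hd : Odd d) (hbc : Odd (b + c)) :
    Irreducible (monicCubic b c d) := by
  have hdeg := natDegree_monicCubic b c d
  rw [(monic_monicCubic b c d).irreducible_iff_roots_eq_zero_of_degree_le_three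
    (by omega) (by omega), Multiset.eq_zero_iff_forall_notMem]
  intro r hr
  have h : r ^ 3 + b * r ^ 2 + c * r + d = 0 := by
    simpa [monicCubic, Cubic.toPoly] using (mem_roots'.mp hr).2
  have hmod := congrArg (Int.cast : ℤ → ZMod 2) h
  have hd_mod := ZMod.intCast_eq_one_iff_odd.mpr hd
  have hbc_mod := ZMod.intCast_eq_one_iff_odd.mpr hbc
  push_cast at hmod hd_mod hbc_mod
  generalize (b : ZMod 2) = b, (c : ZMod 2) = c, (d : ZMod 2) = d, (r : ZMod 2) = r at *
  revert b c d r
  decide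

lemma isEisensteinAt_monicCubic {p : ℕ} (hp : p.Prime) (hb : (p : ℤ) ∣ b) (hc : (p : ℤ) ∣ c)
    (hd : (p : ℤ) ∣ d) (hd' : ¬ (p : ℤ) ^ 2 ∣ d) :
    (monicCubic b c d).IsEisensteinAt (Ideal.span {(p : ℤ)}) := by
  refine (monic_monicCubic b c d).isEisensteinAt_of_mem_of_notMem ?_ (fun {n} hn ↦ ?_) ?_
  · rw [Ne, Ideal.span_singleton_eq_top]
    exact (Nat.prime_iff_prime_int.mp hp).not_isUnit
  · rw [natDegree_monicCubic] at hn
    rw [Ideal.mem_span_singleton]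
    interval_cases n <;> simpa [monicCubic]
  · rw [Ideal.span_singleton_pow, Ideal.mem_span_singleton]
    simpa [monicCubic]

end IntegralCubic

section RootField

open NumberField

lemma minpoly_eq_of_irreducible_of_monic_int {L : Type*} [Field L] [CharZero L] {f : ℤ[X]}
    (hf : f.Monic) (hirr : Irreducible f) {x : L} (hx : aeval x f = 0) : minpoly ℤ x = f := by
  have hx' : IsIntegral ℤ x := ⟨f, hf, hx⟩
  refine map_injective _ (algebraMap ℤ ℚ).injective_int ?_
  rw [← minpoly.isIntegrallyClosed_eq_field_fractions' ℚ hx']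
  exact (minpoly.eq_of_irreducible_of_monic
    (hf.irreducible_iff_irreducible_map_fraction_map.mp hirr) (by rwa [aeval_map_algebraMap])
    (hf.map _)).symm

lemma exists_numberField_adjoin_root {f : ℤ[X]} (hf : f.Monic) (hirr : Irreducible f) {α : ℂ}
    (hα : aeval α f = 0) :
    ∃ _ : NumberField (IntermediateField.adjoin ℚ {α}),
      ∃ θ : 𝓞 (IntermediateField.adjoin ℚ {α}), minpoly ℤ θ = f ∧
        IntermediateField.adjoin ℚ {(θ : IntermediateField.adjoin ℚ {α})} = ⊤ := by
  have hα' : IsIntegral ℚ α := IsIntegral.tower_top (R := ℤ) ⟨f, hf, hα⟩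
  have := IntermediateField.adjoin.finiteDimensional hα'
  have hgen : aeval (IntermediateField.AdjoinSimple.gen ℚ α) f = 0 :=
    (aeval_algebraMap_eq_zero_iff ℂ _ f).mp (by rwa [IntermediateField.AdjoinSimple.algebraMap_gen])
  obtain ⟨θ, hθ⟩ : ∃ θ : 𝓞 (IntermediateField.adjoin ℚ {α}),
      (θ : IntermediateField.adjoin ℚ {α}) = IntermediateField.AdjoinSimple.gen ℚ α :=
    ⟨⟨_, ⟨f, hf, hgen⟩⟩, rfl⟩
  refine ⟨⟨⟩, θ, ?_, ?_⟩
  · rw [← RingOfIntegers.minpoly_coe, hθ, minpoly_eq_of_irreducible_of_monic_int hf hirr hgen]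
  · rw [Field.primitive_element_iff_minpoly_natDegree_eq, hθ]
    exact (congrArg natDegree (IntermediateField.minpoly_gen ℚ α)).trans
      (IntermediateField.adjoin.finrank hα').symm

lemma mahler_eq_of_minpoly_eq {K : Type*} [Field K] [NumberField K] {θ : 𝓞 K} {f : ℤ[X]}
    (hθ : minpoly ℤ θ = f) : mahler θ = (f.map (Int.castRingHom ℂ)).mahlerMeasure := by
  rw [mahler, RingOfIntegers.minpoly_coe, hθ]

end RootField

section FamilyDiscriminants

open NumberField

variable {K : Type*} [Field K] [NumberField K] {θ : 𝓞 K}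

lemma not_sq_dvd_of_squarefree {p : ℕ} (hp : p.Prime) {m : ℤ} (hm : Squarefree m) :
    ¬ (p : ℤ) ^ 2 ∣ m := fun h ↦
  (Nat.prime_iff_prime_int.mp hp).not_isUnit (hm _ (sq (p : ℤ) ▸ h))

lemma discr_eq_of_minpoly_eq_trinomial (hθ : IntermediateField.adjoin ℚ {(θ : K)} = ⊤) {k d : ℤ}
    (hmin : minpoly ℤ θ = monicCubic (k * d) 0 d) (hd : Squarefree d)
    (hD : Squarefree (4 * k ^ 3 * d ^ 2 + 27)) :
    discr K = -(d ^ 2 * (4 * k ^ 3 * d ^ 2 + 27)) := by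
  have hdiscr : (monicCubic (k * d) 0 d).discr = -(d ^ 2 * (4 * k ^ 3 * d ^ 2 + 27)) := by
    rw [discr_monicCubic]
    ring
  rw [discr_eq_discr_minpoly hθ, hmin, hdiscr]
  intro p hp hpD
  rw [hmin, hdiscr, dvd_neg] at hpD
  by_cases hpd : (p : ℤ) ∣ d
  · apply isMaximalAt_of_isEisensteinAt hp hθ
    rw [hmin]
    exact isEisensteinAt_monicCubic hp (hpd.mul_left k) (dvd_zero _) hpd
      (not_sq_dvd_of_squarefree hp hd)
  · have hcop : IsCoprime ((p : ℤ) ^ 2) (d ^ 2) :=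
      ((Nat.prime_iff_prime_int.mp hp).coprime_iff_not_dvd.mpr hpd).pow
    exact absurd (hcop.dvd_of_dvd_mul_left hpD) (not_sq_dvd_of_squarefree hp hD)

lemma not_dvd_three_of_dvd_of_squarefree {p : ℕ} (hp : p.Prime) {n : ℤ}
    (hn : Squarefree (n ^ 2 + 3 * n + 9)) (hpn : (p : ℤ) ∣ n ^ 2 + 3 * n + 9) :
    ¬ (p : ℤ) ∣ 3 := by
  intro h
  obtain rfl := (Nat.prime_dvd_prime_iff_eq hp Nat.prime_three).mp (by exact_mod_cast h)
  obtain ⟨m, rfl⟩ : (3 : ℤ) ∣ n := by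
    refine Int.prime_three.dvd_of_dvd_pow (n := 2) ?_
    push_cast at hpn
    omega
  exact not_sq_dvd_of_squarefree hp hn ⟨m ^ 2 + m + 1, by push_cast; ring⟩

/-- The translation completes the cube modulo `p²`: if `3 k ≡ n`, the coefficients become `0`,
`-N / 3` and `(2 n + 3) N / 27` with `N = n² + 3 n + 9`, and `(2 n + 3)² = 4 N - 27`. -/
lemma exists_isEisensteinAt_simplest_comp {p : ℕ} (hp : p.Prime) {n : ℤ}
    (hn : Squarefree (n ^ 2 + 3 * n + 9)) (hpn : (p : ℤ) ∣ n ^ 2 + 3 * n + 9) :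
    ∃ k : ℤ, ((monicCubic n (-(n + 3)) 1).comp (X - C k)).IsEisensteinAt
      (Ideal.span {(p : ℤ)}) := by
  have hp' := Nat.prime_iff_prime_int.mp hp
  have hp3 : IsCoprime (p : ℤ) 3 :=
    hp'.coprime_iff_not_dvd.mpr (not_dvd_three_of_dvd_of_squarefree hp hn hpn)
  have hp27 : IsCoprime (p : ℤ) 27 := by simpa using hp3.pow_right (n := 3)
  have hp23 : IsCoprime (p : ℤ) (2 * n + 3) := by
    refine hp'.coprime_iff_not_dvd.mpr fun h ↦ hp'.not_isUnit (hp27.isUnit_of_dvd' dvd_rfl ?_)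
    rw [show (27 : ℤ) = (n ^ 2 + 3 * n + 9) * 4 - (2 * n + 3) * (2 * n + 3) by ring]
    exact dvd_sub (hpn.mul_right _) (h.mul_right _)
  obtain ⟨k, hk⟩ : ∃ k, (p : ℤ) ^ 2 ∣ n - 3 * k := by
    obtain ⟨r, s, hrs⟩ := hp3.pow_left (m := 2)
    exact ⟨s * n, r * n, by linear_combination -n * hrs⟩
  have hkp : (p : ℤ) ∣ n - 3 * k := (dvd_pow_self _ two_ne_zero).trans hk
  have hc : 3 * (3 * k ^ 2 - 2 * n * k + -(n + 3)) =
      (n - 3 * k) * (n - 3 * k) - (n ^ 2 + 3 * n + 9) := by ring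
  have hd : 27 * (-k ^ 3 + n * k ^ 2 - -(n + 3) * k + 1) = (2 * n + 3) * (n ^ 2 + 3 * n + 9) +
      (n - 3 * k) * ((n - 3 * k) ^ 2 - 3 * (n ^ 2 + 3 * n + 9)) := by ring
  refine ⟨k, ?_⟩
  rw [monicCubic_comp_X_sub_C]
  refine isEisensteinAt_monicCubic hp hkp (hp3.dvd_of_dvd_mul_left ?_)
    (hp27.dvd_of_dvd_mul_left ?_) fun h ↦ ?_
  · exact hc ▸ dvd_sub (hkp.mul_right _) hpn
  · exact hd ▸ dvd_add (hpn.mul_left _) (hkp.mul_right _)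
  · exact not_sq_dvd_of_squarefree hp hn (hp23.pow_left.dvd_of_dvd_mul_left
      ((dvd_add_left (hk.mul_right _)).mp (hd ▸ h.mul_left 27)))

lemma discr_eq_of_minpoly_eq_simplest (hθ : IntermediateField.adjoin ℚ {(θ : K)} = ⊤) {n : ℤ}
    (hmin : minpoly ℤ θ = monicCubic n (-(n + 3)) 1) (hn : Squarefree (n ^ 2 + 3 * n + 9)) :
    discr K = (n ^ 2 + 3 * n + 9) ^ 2 := by
  have hdiscr : (monicCubic n (-(n + 3)) 1).discr = (n ^ 2 + 3 * n + 9) ^ 2 := by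
    rw [discr_monicCubic]
    ring
  rw [discr_eq_discr_minpoly hθ, hmin, hdiscr]
  intro p hp hpD
  rw [hmin, hdiscr] at hpD
  have hpn : (p : ℤ) ∣ n ^ 2 + 3 * n + 9 :=
    (Nat.prime_iff_prime_int.mp hp).dvd_of_dvd_pow ((dvd_pow_self _ two_ne_zero).trans hpD)
  obtain ⟨k, hk⟩ := exists_isEisensteinAt_simplest_comp hp hn hpn
  exact isMaximalAt_of_isEisensteinAt_comp hp hθ k (hmin ▸ hk)

end FamilyDiscriminants

section MahlerBounds

lemma mahlerMeasure_monicCubic_sq_le (b c d : ℂ) :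
    (monicCubic b c d).mahlerMeasure ^ 2 ≤ 1 + ‖b‖ ^ 2 + ‖c‖ ^ 2 + ‖d‖ ^ 2 := by
  have h := mahlerMeasure_le_sqrt_sum_sq_norm_coeff (monicCubic b c d)
  rw [Real.le_sqrt' (mahlerMeasure_pos_of_ne_zero (monic_monicCubic b c d).ne_zero),
    show ∑ i ∈ _, _ = (monicCubic b c d).sum fun _ a ↦ ‖a‖ ^ 2 from rfl,
    sum_over_range _ (by simp), natDegree_monicCubic] at h
  simp only [monicCubic, Finset.sum_range_succ, Finset.sum_range_zero, Cubic.coeff_eq_a,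
    Cubic.coeff_eq_b, Cubic.coeff_eq_c, Cubic.coeff_eq_d, norm_one] at h
  rw [monicCubic]
  linarith

lemma mahlerMeasure_simplest_bounds {n : ℕ} (hn : 0 < n) :
    1 < (monicCubic (n : ℂ) (-(n + 3)) 1).mahlerMeasure ∧
      (monicCubic (n : ℂ) (-(n + 3)) 1).mahlerMeasure ^ 4 < 4 * ((n : ℝ) ^ 2 + 3 * n + 9) ^ 2 := by
  have hnorm : ‖-((n : ℂ) + 3)‖ = n + 3 := by
    rw [norm_neg]
    exact_mod_cast Complex.norm_natCast (n + 3)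
  have hlower := norm_coeff_le_choose_mul_mahlerMeasure 1 (monicCubic (n : ℂ) (-(n + 3)) 1)
  have hupper := mahlerMeasure_monicCubic_sq_le (n : ℂ) (-(n + 3)) 1
  rw [natDegree_monicCubic, monicCubic, Cubic.coeff_eq_c, hnorm, Nat.choose_one_right] at hlower
  rw [hnorm, Complex.norm_natCast, norm_one] at hupper
  have hn' : (0 : ℝ) < n := mod_cast hn
  constructor
  · push_cast at hlower
    rw [monicCubic]
    linarith
  · rw [show (4 : ℝ) * ((n : ℝ) ^ 2 + 3 * n + 9) ^ 2 = (2 * ((n : ℝ) ^ 2 + 3 * n + 9)) ^ 2 by ring,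
      show 4 = 2 * 2 from rfl, pow_mul]
    refine pow_lt_pow_left₀ ?_ (by positivity) two_ne_zero
    linarith

lemma mahlerMeasure_monicCubic_of_eq_prod {b c d x y z : ℝ}
    (h : monicCubic b c d = (X - C x) * (X - C y) * (X - C z)) :
    (monicCubic (b : ℂ) c d).mahlerMeasure = max 1 |x| * max 1 |y| * max 1 |z| := by
  rw [show monicCubic (b : ℂ) c d = (X - C (x : ℂ)) * (X - C (y : ℂ)) * (X - C (z : ℂ)) by
    simpa [map_monicCubic] using congrArg (Polynomial.map Complex.ofRealHom) h]
  simp only [mahlerMeasure_mul, mahlerMeasure_X_sub_C, Complex.norm_real, Real.norm_eq_abs]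

lemma exists_roots_monicCubic_real {n : ℝ} (hn : 3 ≤ n) : ∃ x y z : ℝ, -1 < x ∧ x < 0 ∧ 1 < y ∧
    y < z ∧ monicCubic (-n) 0 n = (X - C x) * (X - C y) * (X - C z) := by
  have heval (t : ℝ) : (monicCubic (-n) 0 n).eval t = t ^ 3 - n * t ^ 2 + n := by
    rw [← coe_aeval_eq_eval, aeval_monicCubic, Algebra.algebraMap_self]
    simp only [RingHom.id_apply]
    ring
  have hcont (s : Set ℝ) : ContinuousOn (monicCubic (-n) 0 n).eval s :=
    (monicCubic (-n) 0 n).continuousOn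
  obtain ⟨x, ⟨hx₁, hx₂⟩, hx⟩ := intermediate_value_Ioo (by norm_num : (-1 : ℝ) ≤ 0) (hcont _)
    (show (0 : ℝ) ∈ _ by simp only [heval, Set.mem_Ioo]; constructor <;> linarith)
  obtain ⟨y, ⟨hy₁, hy₂⟩, hy⟩ := intermediate_value_Ioo' (by norm_num : (1 : ℝ) ≤ 2) (hcont _)
    (show (0 : ℝ) ∈ _ by simp only [heval, Set.mem_Ioo]; constructor <;> linarith)
  obtain ⟨z, ⟨hz₁, -⟩, hz⟩ := intermediate_value_Ioo (by linarith : (2 : ℝ) ≤ n) (hcont _)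
    (show (0 : ℝ) ∈ _ by simp only [heval, Set.mem_Ioo]; constructor <;> linarith)
  exact ⟨x, y, z, hx₁, hx₂, hy₁, hy₂.trans hz₁, monicCubic_eq_prod_of_roots hx hy hz
    (by linarith) (by linarith) (by linarith)⟩

lemma mahlerMeasure_real_bounds {n : ℝ} (hn : 4 ≤ n) :
    1 < (monicCubic (-n : ℂ) 0 n).mahlerMeasure ∧
      (monicCubic (-n : ℂ) 0 n).mahlerMeasure ^ 4 < n ^ 2 * (4 * n ^ 2 - 27) := by
  obtain ⟨x, y, z, hx₁, hx₂, hy, hyz, hprod⟩ := exists_roots_monicCubic_real (by linarith : 3 ≤ n)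
  obtain ⟨hsum, hpair, hxyz⟩ := monicCubic_eq_prod_iff.mp hprod
  have hM : (monicCubic (-n : ℂ) 0 n).mahlerMeasure = y * z := by
    have h := mahlerMeasure_monicCubic_of_eq_prod hprod
    rw [abs_of_neg hx₂, abs_of_pos (by linarith), abs_of_pos (by linarith),
      max_eq_left (by linarith), max_eq_right hy.le, max_eq_right (by linarith), one_mul] at h
    simpa using h
  have hsq : (y * z) ^ 2 = n * (n - x) := by
    linear_combination (-y * z) * hpair + n * hsum - (y + z) * hxyz
  rw [hM]
  refine ⟨one_lt_mul_of_lt_of_le hy (hy.trans hyz).le, ?_⟩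
  calc (y * z) ^ 4 = (n * (n - x)) ^ 2 := by rw [← hsq]; ring
    _ < (n * (n + 1)) ^ 2 := by gcongr <;> nlinarith
    _ ≤ n ^ 2 * (4 * n ^ 2 - 27) := by
      rw [mul_pow]
      gcongr
      nlinarith

/-- The two roots are conjugate, of square norm `v`. -/
lemma mahlerMeasure_quadratic_of_sq_le {u v : ℝ} (h : u ^ 2 ≤ 4 * v) :
    (X ^ 2 - C (u : ℂ) * X + C (v : ℂ)).mahlerMeasure = max 1 v := by
  let w : ℂ := ⟨u / 2, √(4 * v - u ^ 2) / 2⟩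
  have hw : Complex.normSq w = v := by
    rw [Complex.normSq_mk, ← sq, ← sq, div_pow, div_pow, Real.sq_sqrt (sub_nonneg.mpr h)]
    ring
  have hadd : w + starRingEnd ℂ w = u := by
    rw [Complex.add_conj, mul_div_cancel₀ u two_ne_zero]
  have hprod : X ^ 2 - C (u : ℂ) * X + C (v : ℂ) = (X - C w) * (X - C (starRingEnd ℂ w)) := by
    rw [← hadd, ← hw, ← Complex.mul_conj, C_add, C_mul]
    ring
  rw [hprod, mahlerMeasure_mul, mahlerMeasure_X_sub_C, mahlerMeasure_X_sub_C, RCLike.norm_conj,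
    ← sq, ← hw, Complex.normSq_eq_norm_sq]
  rcases le_total 1 ‖w‖ with h1 | h1
  · rw [max_eq_right h1, max_eq_right (one_le_pow₀ h1)]
  · rw [max_eq_left h1, max_eq_left (pow_le_one₀ (norm_nonneg w) h1), one_pow]

lemma exists_root_monicCubic_complex {n : ℝ} (hn : 0 < n) :
    ∃ s : ℝ, n < s ∧ s ^ 2 * (s - n) = n := by
  obtain ⟨s, ⟨hs, -⟩, h⟩ := intermediate_value_Ioo (by linarith : n ≤ n + 1)
    (f := fun t ↦ t ^ 2 * (t - n)) (by fun_prop)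
    (show n ∈ _ by simp only [Set.mem_Ioo]; constructor <;> nlinarith)
  exact ⟨s, hs, h⟩

lemma mahlerMeasure_complex_bounds {n : ℝ} (hn : 2 ≤ n) :
    1 < (monicCubic (n : ℂ) 0 n).mahlerMeasure ∧
      4 * (monicCubic (n : ℂ) 0 n).mahlerMeasure ^ 4 < n ^ 2 * (4 * n ^ 2 + 27) := by
  obtain ⟨s, hs, hroot⟩ := exists_root_monicCubic_complex (by linarith : 0 < n)
  have hlt : s * (s - n) < 1 := by nlinarith
  have hM : (monicCubic (n : ℂ) 0 n).mahlerMeasure = s := by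
    have hrootC : C (s : ℂ) ^ 2 * (C (s : ℂ) - C (n : ℂ)) = C (n : ℂ) := by
      simpa using congrArg (fun t : ℝ ↦ C (t : ℂ)) hroot
    have hfactor : monicCubic (n : ℂ) 0 n =
        (X - C (-s : ℂ)) * (X ^ 2 - C ((s - n : ℝ) : ℂ) * X + C ((s * (s - n) : ℝ) : ℂ)) := by
      simp only [monicCubic, Cubic.toPoly, Complex.ofReal_mul, Complex.ofReal_sub, map_one,
        map_zero, map_neg, map_sub, map_mul]
      linear_combination -hrootC
    rw [hfactor, mahlerMeasure_mul, mahlerMeasure_quadratic_of_sq_le (by nlinarith),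
      mahlerMeasure_X_sub_C, norm_neg, Complex.norm_real, Real.norm_eq_abs,
      abs_of_pos (by linarith), max_eq_right (by linarith), max_eq_left hlt.le, mul_one]
  have hsq : s ^ 2 < n ^ 2 + 2 := by nlinarith
  rw [hM]
  refine ⟨by linarith, ?_⟩
  calc 4 * s ^ 4 = 4 * (s ^ 2) ^ 2 := by ring
    _ < 4 * (n ^ 2 + 2) ^ 2 := by gcongr
    _ ≤ n ^ 2 * (4 * n ^ 2 + 27) := by nlinarith

end MahlerBounds

section CubicFields

open NumberField

lemma finrank_eq_three_of_minpoly_eq_monicCubic {K : Type*} [Field K] [NumberField K] {θ : 𝓞 K}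
    (hθ : IntermediateField.adjoin ℚ {(θ : K)} = ⊤) {b c d : ℤ}
    (hmin : minpoly ℤ θ = monicCubic b c d) : finrank ℚ K = 3 := by
  rw [← natDegree_minpoly_of_adjoin_eq_top hθ, hmin, natDegree_monicCubic]

lemma exists_complex_root_monicCubic (b c d : ℤ) : ∃ x : ℂ, aeval x (monicCubic b c d) = 0 :=
  IsAlgClosed.exists_aeval_eq_zero ℂ _ (degree_ne_of_natDegree_ne (by simp [natDegree_monicCubic]))

lemma exists_hasMinIntegralMahler_lt {K : Type*} [Field K] [NumberField K] {θ : 𝓞 K}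
    (hθ : IntermediateField.adjoin ℚ {(θ : K)} = ⊤) {f : ℤ[X]} (hmin : minpoly ℤ θ = f)
    (hf : 1 < (f.map (Int.castRingHom ℂ)).mahlerMeasure) {c : ℝ} (hc : 0 ≤ c)
    (hfc : (f.map (Int.castRingHom ℂ)).mahlerMeasure ^ 4 < c ^ 4 * absDiscr K) :
    ∃ m, HasMinIntegralMahler K m ∧ m < c * absDiscr K ^ (1 / 4 : ℝ) := by
  rw [← mahler_eq_of_minpoly_eq hmin] at hf hfc
  obtain ⟨m, hm, hle⟩ := exists_hasMinIntegralMahler_le hθ hf.ne'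
  exact ⟨m, hm, hle.trans_lt (lt_mul_rpow_quarter hc (abs_nonneg _) hfc)⟩

lemma two_rpow_half_pow_four : ((2 : ℝ) ^ (1 / 2 : ℝ)) ^ 4 = 4 := by
  rw [← Real.rpow_natCast, ← Real.rpow_mul zero_le_two]
  norm_num

lemma two_rpow_neg_half_pow_four : ((2 : ℝ) ^ (-(1 / 2) : ℝ)) ^ 4 = 1 / 4 := by
  rw [Real.rpow_neg zero_le_two, inv_pow, two_rpow_half_pow_four, one_div]

end CubicFields

section SimplestCubicFields

lemma monicCubic_simplest_eq_prod {F : Type*} [Field F] {n a : F}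
    (ha : (monicCubic n (-(n + 3)) 1).IsRoot a) : monicCubic n (-(n + 3)) 1 =
      (X - C a) * (X - C (1 - a)⁻¹) * (X - C (1 - a⁻¹)) := by
  rw [IsRoot, ← coe_aeval_eq_eval, aeval_monicCubic] at ha
  simp only [Algebra.algebraMap_self, RingHom.id_apply] at ha
  have h₀ : a ≠ 0 := by
    rintro rfl
    simp at ha
  have h₁ : 1 - a ≠ 0 := fun h ↦ one_ne_zero (α := F) <| by
    linear_combination -ha - (a ^ 2 + (n + 1) * a - 2) * h
  refine monicCubic_eq_prod_iff.mpr ⟨?_, ?_, ?_⟩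
  · field_simp
    linear_combination -ha
  · field_simp
    linear_combination ha
  · field_simp
    ring

lemma isGalois_adjoin_rootSet (f : ℚ[X]) :
    IsGalois ℚ (IntermediateField.adjoin ℚ (f.rootSet ℂ)) := by
  have hsplit : IsSplittingField ℚ (IntermediateField.adjoin ℚ (f.rootSet ℂ)) f :=
    IntermediateField.adjoin_rootSet_isSplittingField (IsAlgClosed.splits _)
  have hnormal := Normal.of_isSplittingField (hFEp := hsplit) f
  exact ⟨⟩

lemma simplestCubic_eq_map (n : ℕ) : simplestCubic n =
    (monicCubic (n : ℤ) (-(n + 3)) 1).map (algebraMap ℤ ℚ) := by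
  rw [map_monicCubic, simplestCubic, monicCubic, Cubic.toPoly, map_neg (algebraMap ℤ ℚ), C_neg,
    neg_mul]
  simp [sub_eq_add_neg, -neg_add_rev]

lemma isSplittingFieldIn_simplestCubic {n : ℕ} {a : ℂ}
    (ha : aeval a (monicCubic (n : ℤ) (-(n + 3)) 1) = 0) :
    IsSplittingFieldIn (simplestCubic n) (IntermediateField.adjoin ℚ {a}) := by
  have hroot (x : ℂ) : aeval x (monicCubic (n : ℤ) (-(n + 3)) 1) = 0 ↔
      (monicCubic (n : ℂ) (-(n + 3)) 1).IsRoot x := by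
    rw [IsRoot, ← eval_map_algebraMap, map_monicCubic]
    push_cast
    rfl
  have hne := ((monic_monicCubic (n : ℤ) (-(n + 3)) 1).map (algebraMap ℤ ℚ)).ne_zero
  have hmem (x : ℂ) : x ∈ (simplestCubic n).rootSet ℂ ↔
      (monicCubic (n : ℂ) (-(n + 3)) 1).IsRoot x := by
    rw [simplestCubic_eq_map, mem_rootSet_of_ne hne, aeval_map_algebraMap, hroot]
  rw [hroot] at ha
  have haK := IntermediateField.mem_adjoin_simple_self ℚ a
  refine le_antisymm (IntermediateField.adjoin_simple_le_iff.mpr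
    (IntermediateField.subset_adjoin _ _ ((hmem a).mpr ha)))
    (IntermediateField.adjoin_le_iff.mpr fun w hw ↦ ?_)
  rw [hmem, monicCubic_simplest_eq_prod ha, root_mul, root_mul, root_X_sub_C, root_X_sub_C,
    root_X_sub_C] at hw
  rcases hw with (rfl | rfl) | rfl
  · exact haK
  · exact inv_mem (sub_mem (one_mem _) haK)
  · exact sub_mem (one_mem _) (inv_mem haK)

lemma hasUnboundedDiscr_simplestCubic : HasUnboundedDiscr fun K _ ↦
    (∃ n : ℕ, IsSplittingFieldIn (simplestCubic n) K) ∧ IsCyclicCubic K ∧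
      ∃ m, HasMinIntegralMahler K m ∧ m < 2 ^ (1 / 2 : ℝ) * absDiscr K ^ (1 / 4 : ℝ) := by
  intro B
  obtain ⟨n, hnB, hn⟩ := exists_squarefree_simplest_discr (⌈B⌉₊ + 1)
  have hirr : Irreducible (monicCubic (n : ℤ) (-(n + 3)) 1) :=
    irreducible_monicCubic_of_odd odd_one ⟨-2, by ring⟩
  have hmonic := monic_monicCubic (n : ℤ) (-(n + 3)) 1
  obtain ⟨a, ha⟩ := exists_complex_root_monicCubic (n : ℤ) (-(n + 3)) 1
  obtain ⟨hK, θ, hmin, hθ⟩ := exists_numberField_adjoin_root hmonic hirr ha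
  have hsplit := isSplittingFieldIn_simplestCubic ha
  have hgal : IsGalois ℚ (IntermediateField.adjoin ℚ {a}) := by
    rw [hsplit]
    exact isGalois_adjoin_rootSet _
  have hD : absDiscr (IntermediateField.adjoin ℚ {a}) = ((n : ℝ) ^ 2 + 3 * n + 9) ^ 2 := by
    rw [absDiscr, discr_eq_of_minpoly_eq_simplest hθ hmin hn, abs_of_nonneg (by positivity)]
    push_cast
    rfl
  have hM := mahlerMeasure_simplest_bounds (n := n) (by omega)
  have hBn : B ≤ n := (Nat.le_ceil B).trans (by exact_mod_cast (by omega : ⌈B⌉₊ ≤ n))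
  refine ⟨_, hK, ⟨⟨n, hsplit⟩, isCyclicCubic_of_isGalois
    (finrank_eq_three_of_minpoly_eq_monicCubic hθ hmin),
    exists_hasMinIntegralMahler_lt hθ hmin ?_ (by positivity) ?_⟩, ?_⟩
  · simpa [map_monicCubic] using hM.1
  · rw [two_rpow_half_pow_four, hD]
    simpa [map_monicCubic] using hM.2
  · rw [hD]
    nlinarith

end SimplestCubicFields

section TrinomialFields

open NumberField

lemma isRootField_adjoin_root {f : ℤ[X]} (hf : f.Monic) {α : ℂ} (hα : aeval α f = 0) :
    IsRootField (f.map (algebraMap ℤ ℚ)) (IntermediateField.adjoin ℚ {α}) :=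
  ⟨α, mem_rootSet.mpr ⟨(hf.map _).ne_zero, by rwa [aeval_map_algebraMap]⟩, rfl⟩

lemma exists_rootField_trinomial {k : ℤ} (hk : |k| = 1) (B : ℕ) :
    ∃ n ≥ B, ∃ (K : IntermediateField ℚ ℂ) (_ : NumberField K) (θ : 𝓞 K),
      IsRootField ((monicCubic (k * n) 0 (n : ℤ)).map (algebraMap ℤ ℚ)) K ∧
      IntermediateField.adjoin ℚ {(θ : K)} = ⊤ ∧ minpoly ℤ θ = monicCubic (k * n) 0 (n : ℤ) ∧
      discr K = -(n ^ 2 * (4 * k ^ 3 * n ^ 2 + 27)) := by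
  obtain ⟨n, hnB, hodd, hn, hD⟩ := exists_squarefree_trinomial_discr hk B
  have hodd' : Odd (n : ℤ) := by exact_mod_cast hodd
  have hk' : Odd k := odd_abs.mp (hk ▸ odd_one)
  have hirr : Irreducible (monicCubic (k * n) 0 (n : ℤ)) :=
    irreducible_monicCubic_of_odd hodd' (by rw [add_zero]; exact hk'.mul hodd')
  have hmonic := monic_monicCubic (k * n) 0 (n : ℤ)
  obtain ⟨α, hα⟩ := exists_complex_root_monicCubic (k * n) 0 (n : ℤ)
  obtain ⟨hK, θ, hmin, hθ⟩ := exists_numberField_adjoin_root hmonic hirr hα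
  exact ⟨n, hnB, _, hK, θ, isRootField_adjoin_root hmonic hα, hθ, hmin,
    discr_eq_of_minpoly_eq_trinomial hθ hmin hn hD⟩

lemma not_isSquare_sq_mul_four_mul_sq_sub {n : ℤ} (hn : 7 < n) :
    ¬ IsSquare (n ^ 2 * (4 * n ^ 2 - 27)) := by
  rintro ⟨r, hr⟩
  obtain ⟨k, rfl⟩ : n ∣ r := by
    rw [← Int.pow_dvd_pow_iff two_ne_zero, sq r, ← hr]
    exact dvd_mul_right _ _
  have hk : |k| ^ 2 = 4 * n ^ 2 - 27 := by
    rw [sq_abs]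
    exact mul_left_cancel₀ (by positivity : n ^ 2 ≠ 0) (by linear_combination -hr)
  have hlt : |k| < 2 * n := lt_of_pow_lt_pow_left₀ 2 (by omega) (by linarith)
  have hgt : 2 * n - 1 < |k| := lt_of_pow_lt_pow_left₀ 2 (abs_nonneg k) (by linarith)
  omega

lemma realCubic_eq_map (n : ℕ) :
    realCubic n = (monicCubic (-1 * (n : ℤ)) 0 n).map (algebraMap ℤ ℚ) := by
  rw [map_monicCubic]
  simp [realCubic, monicCubic, Cubic.toPoly, sub_eq_add_neg]

lemma complexCubic_eq_map (n : ℕ) :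
    complexCubic n = (monicCubic (1 * (n : ℤ)) 0 n).map (algebraMap ℤ ℚ) := by
  rw [map_monicCubic]
  simp [complexCubic, monicCubic, Cubic.toPoly]

lemma hasUnboundedDiscr_realCubic : HasUnboundedDiscr fun K _ ↦
    (∃ n : ℕ, IsRootField (realCubic n) K) ∧ IsTotallyRealNonGaloisCubic K ∧
      ∃ m, HasMinIntegralMahler K m ∧ m < absDiscr K ^ (1 / 4 : ℝ) := by
  intro B
  obtain ⟨n, hnB, K, hK, θ, hroot, hθ, hmin, hdiscr⟩ :=
    exists_rootField_trinomial (k := -1) (by norm_num) (⌈B⌉₊ + 8)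
  replace hdiscr : discr K = n ^ 2 * (4 * n ^ 2 - 27) := by
    rw [hdiscr]
    ring
  have hn : 8 ≤ (n : ℤ) := by omega
  have hpos : 0 < (n : ℤ) ^ 2 * (4 * n ^ 2 - 27) := mul_pos (by positivity) (by nlinarith)
  have hD : absDiscr K = (n : ℝ) ^ 2 * (4 * n ^ 2 - 27) := by
    rw [absDiscr, hdiscr, abs_of_pos (by exact_mod_cast hpos)]
    push_cast
    rfl
  have h3 := finrank_eq_three_of_minpoly_eq_monicCubic hθ hmin
  have hn' : (8 : ℝ) ≤ n := by exact_mod_cast hn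
  have hM := mahlerMeasure_real_bounds (n := n) (by linarith)
  have hBn : B ≤ n := (Nat.le_ceil B).trans (by exact_mod_cast (by omega : ⌈B⌉₊ ≤ n))
  refine ⟨K, hK, ⟨⟨n, realCubic_eq_map n ▸ hroot⟩, ⟨h3, ?_, fun hgal ↦ ?_⟩, ?_⟩, ?_⟩
  · rw [isTotallyReal_iff_discr_pos_of_finrank_le_three h3.le, hdiscr]
    exact hpos
  · refine not_isSquare_sq_mul_four_mul_sq_sub (by omega : 7 < (n : ℤ)) ?_
    rw [← hdiscr]
    exact isSquare_discr_of_isGalois_of_odd_finrank (h3 ▸ by decide)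
  · rw [← one_mul (absDiscr K ^ _)]
    refine exists_hasMinIntegralMahler_lt hθ hmin ?_ zero_le_one ?_
    · simpa [map_monicCubic] using hM.1
    · rw [hD]
      simpa [map_monicCubic] using hM.2
  · rw [hD]
    have hn4 : (n : ℝ) ≤ 4 * n ^ 2 - 27 := by nlinarith
    nlinarith

lemma hasUnboundedDiscr_complexCubic : HasUnboundedDiscr fun K _ ↦
    (∃ n : ℕ, IsRootField (complexCubic n) K) ∧ IsNonTotallyRealCubic K ∧
      ∃ m, HasMinIntegralMahler K m ∧ m < 2 ^ (-(1 / 2) : ℝ) * absDiscr K ^ (1 / 4 : ℝ) := by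
  intro B
  obtain ⟨n, hnB, K, hK, θ, hroot, hθ, hmin, hdiscr⟩ :=
    exists_rootField_trinomial (k := 1) (by norm_num) (⌈B⌉₊ + 2)
  have hD : absDiscr K = (n : ℝ) ^ 2 * (4 * n ^ 2 + 27) := by
    rw [absDiscr, hdiscr]
    push_cast
    rw [abs_neg, abs_of_nonneg (by positivity)]
  have h3 := finrank_eq_three_of_minpoly_eq_monicCubic hθ hmin
  have hn : (2 : ℝ) ≤ n := by exact_mod_cast (by omega : 2 ≤ n)
  have hM := mahlerMeasure_complex_bounds hn
  have hBn : B ≤ n := (Nat.le_ceil B).trans (by exact_mod_cast (by omega : ⌈B⌉₊ ≤ n))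
  refine ⟨K, hK, ⟨⟨n, complexCubic_eq_map n ▸ hroot⟩, ⟨h3, ?_⟩,
    exists_hasMinIntegralMahler_lt hθ hmin ?_ (by positivity) ?_⟩, ?_⟩
  · rw [isTotallyReal_iff_discr_pos_of_finrank_le_three h3.le, hdiscr, Left.neg_pos_iff, not_lt]
    positivity
  · simpa [map_monicCubic] using hM.1
  · rw [two_rpow_neg_half_pow_four, hD, one_div, ← div_eq_inv_mul, lt_div_iff₀' four_pos]
    simpa [map_monicCubic] using hM.2
  · rw [hD]
    nlinarith

end TrinomialFields

end CubicMahler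

theorem theorem1 :
    -- infinitely many fields of each type with `M(𝓞 K) ≤ 2^(1/2) |D_K|^(1/4)`
    (InfinitelyManyFields (fun K _ => IsCyclicCubic K ∧
        ∃ m, HasMinIntegralMahler K m ∧ m ≤ 2 ^ (1 / 2 : ℝ) * absDiscr K ^ (1 / 4 : ℝ)) ∧
      InfinitelyManyFields (fun K _ => IsTotallyRealNonGaloisCubic K ∧
        ∃ m, HasMinIntegralMahler K m ∧ m ≤ 2 ^ (1 / 2 : ℝ) * absDiscr K ^ (1 / 4 : ℝ)) ∧
      InfinitelyManyFields (fun K _ => IsNonTotallyRealCubic K ∧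
        ∃ m, HasMinIntegralMahler K m ∧ m ≤ 2 ^ (1 / 2 : ℝ) * absDiscr K ^ (1 / 4 : ℝ))) ∧
    -- the exponent `1/4` cannot be increased in a lower bound, for any of the three types
    (ExponentQuarterIsSharp (fun K _ => IsCyclicCubic K) ∧
      ExponentQuarterIsSharp (fun K _ => IsTotallyRealNonGaloisCubic K) ∧
      ExponentQuarterIsSharp (fun K _ => IsNonTotallyRealCubic K)) ∧
    -- such fields occur in three explicit families, with the constants `2^(1/2)`, `1`, `2^(-1/2)`
    (InfinitelyManyFields (fun K _ => (∃ n : ℕ, IsSplittingFieldIn (simplestCubic n) K) ∧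
        IsCyclicCubic K ∧
        ∃ m, HasMinIntegralMahler K m ∧ m < 2 ^ (1 / 2 : ℝ) * absDiscr K ^ (1 / 4 : ℝ)) ∧
      InfinitelyManyFields (fun K _ => (∃ n : ℕ, IsRootField (realCubic n) K) ∧
        IsTotallyRealNonGaloisCubic K ∧
        ∃ m, HasMinIntegralMahler K m ∧ m < absDiscr K ^ (1 / 4 : ℝ)) ∧
      InfinitelyManyFields (fun K _ => (∃ n : ℕ, IsRootField (complexCubic n) K) ∧
        IsNonTotallyRealCubic K ∧
        ∃ m, HasMinIntegralMahler K m ∧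
          m < 2 ^ (-(1 / 2) : ℝ) * absDiscr K ^ (1 / 4 : ℝ))) := by
  have hcyc := hasUnboundedDiscr_simplestCubic.mono (Q := fun K _ ↦ IsCyclicCubic K ∧
      ∃ m, HasMinIntegralMahler K m ∧ m ≤ 2 ^ (1 / 2 : ℝ) * absDiscr K ^ (1 / 4 : ℝ))
    fun K _ ⟨_, hK, m, hm, hlt⟩ ↦ ⟨hK, m, hm, hlt.le⟩
  have hreal := hasUnboundedDiscr_realCubic.mono (Q := fun K _ ↦ IsTotallyRealNonGaloisCubic K ∧
      ∃ m, HasMinIntegralMahler K m ∧ m ≤ 2 ^ (1 / 2 : ℝ) * absDiscr K ^ (1 / 4 : ℝ))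
    fun K _ ⟨_, hK, m, hm, hlt⟩ ↦ ⟨hK, m, hm, hlt.le.trans (le_mul_of_one_le_left
      (Real.rpow_nonneg (abs_nonneg _) _) (Real.one_le_rpow one_le_two (by norm_num)))⟩
  have hcomplex := hasUnboundedDiscr_complexCubic.mono (Q := fun K _ ↦ IsNonTotallyRealCubic K ∧
      ∃ m, HasMinIntegralMahler K m ∧ m ≤ 2 ^ (1 / 2 : ℝ) * absDiscr K ^ (1 / 4 : ℝ))
    fun K _ ⟨_, hK, m, hm, hlt⟩ ↦ ⟨hK, m, hm, hlt.le.trans (mul_le_mul_of_nonneg_right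
      (Real.rpow_le_rpow_of_exponent_le one_le_two (by norm_num))
      (Real.rpow_nonneg (abs_nonneg _) _))⟩
  exact ⟨⟨hcyc.infinitelyManyFields, hreal.infinitelyManyFields, hcomplex.infinitelyManyFields⟩,
    ⟨hcyc.exponentQuarterIsSharp, hreal.exponentQuarterIsSharp, hcomplex.exponentQuarterIsSharp⟩,
    hasUnboundedDiscr_simplestCubic.infinitelyManyFields,
    hasUnboundedDiscr_realCubic.infinitelyManyFields,
    hasUnboundedDiscr_complexCubic.infinitelyManyFields⟩
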